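/- Let $k$ be a commutative associative unital ring; algebras over $k$ are associative but need not be unital. Say that a set $E$ of pairwise orthogonal idempotents of a $k$-algebra $R$ is a set of orthogonal local units of $R$ if $R=\bigoplus_{e\in E}Re=\bigoplus_{e\in E}eR$. For a set $X$ let $\mathrm{FMat}_X(R)$ be the $k$-algebra of all $X\times X$-matrices over $R$ with only finitely many non-zero entries. Let $R$ and $R'$ be $k$-algebras with sets of orthogonal local units $E$ and $F$, respectively, and let $X$ be an infinite set with $|X|\ge |E|$ and $|X|\ge |F|$. Suppose that $R$ and $R'$ are Morita equivalent through a Morita context $(R,R',M,M',\tau,\tau')$ with unital modules and surjective maps; that is, $M$ is an $R$-$R'$-bimodule and $M'$ is an $R'$-$R$-bimodule (with $k$-bilinear actions) such that $RM=M=MR'$ and $R'M'=M'=M'R$, and $\tau:M\otimes_{R'}M'\to R$ and $\tau':M'\otimes_R M\to R'$ are surjective $k$-linear maps of $R$-bimodules and of $R'$-bimodules, respectively, with $$\tau(m_1\otimes m')\,m_2=m_1\,\tau'(m'\otimes m_2),\qquad \tau'(m_1'\otimes m)\,m_2'=m_1'\,\tau(m\otimes m_2')$$ for all $m,m_1,m_2\in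 M$ and $m',m_1',m_2'\in M'$. Then $\mathrm{FMat}_X(R)$ and $\mathrm{FMat}_X(R')$ are isomorphic as $k$-algebras (in particular as rings). -/

import Mathlib

open scoped TensorProduct

namespace StableMorita

/-! Algebras over a commutative unital ring `k` are associative and not necessarily unital:
`[NonUnitalRing R] [Module k R] [IsScalarTower k R R] [SMulCommClass k R R]`.
Mathlib's `Module` needs a unital ring of scalars, hence the bimodules defined here. -/

/-- The structure of an `A`-`B`-bimodule on a `k`-module `M`, for (not necessarily unital)
`k`-algebras `A` and `B`: `left a m` is `a m` and `right b m` is `m b`. -/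
structure Bimod (k A B M : Type*) [CommRing k]
    [NonUnitalRing A] [Module k A] [NonUnitalRing B] [Module k B]
    [AddCommGroup M] [Module k M] where
  left : A →ₗ[k] M →ₗ[k] M
  right : B →ₗ[k] M →ₗ[k] M
  left_mul : ∀ a₁ a₂ m, left (a₁ * a₂) m = left a₁ (left a₂ m)
  right_mul : ∀ b₁ b₂ m, right (b₁ * b₂) m = right b₂ (right b₁ m)
  left_right : ∀ a b m, right b (left a m) = left a (right b m)

/-- The bimodule is unital on both sides: `A M = M` and `M B = M`, where `A M` and `M B` are the
sets of finite sums of products. -/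
structure Bimod.IsUnital {k A B M : Type*} [CommRing k]
    [NonUnitalRing A] [Module k A] [NonUnitalRing B] [Module k B]
    [AddCommGroup M] [Module k M] (S : Bimod k A B M) : Prop where
  left_unital : AddSubgroup.closure {x : M | ∃ a m, S.left a m = x} = ⊤
  right_unital : AddSubgroup.closure {x : M | ∃ b m, S.right b m = x} = ⊤

section Tensor

variable {k A B C M N : Type*} [CommRing k]
  [NonUnitalRing A] [Module k A] [NonUnitalRing B] [Module k B] [NonUnitalRing C] [Module k C]
  [AddCommGroup M] [Module k M] [AddCommGroup N] [Module k N]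

/-- The relations `m b ⊗ n = m ⊗ b n` that cut `M ⊗_B N` out of `M ⊗_k N`. -/
def balancing (S : Bimod k A B M) (T : Bimod k B C N) : Submodule k (M ⊗[k] N) :=
  Submodule.span k {t | ∃ m b n, t = S.right b m ⊗ₜ[k] n - m ⊗ₜ[k] T.left b n}

/-- The tensor product `M ⊗_B N` of an `A`-`B`-bimodule `M` and a `B`-`C`-bimodule `N`. -/
abbrev TensorOver (S : Bimod k A B M) (T : Bimod k B C N) : Type _ :=
  (M ⊗[k] N) ⧸ balancing S T

/-- The pure tensor `m ⊗ n` in `M ⊗_B N`. -/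
def tmulOver (S : Bimod k A B M) (T : Bimod k B C N) (m : M) (n : N) : TensorOver S T :=
  Submodule.Quotient.mk (m ⊗ₜ[k] n)

end Tensor

/-- A Morita context `(R, R', M, M', τ, τ')` of `k`-algebras. -/
structure MoritaContext (k R R' M M' : Type*) [CommRing k]
    [NonUnitalRing R] [Module k R] [NonUnitalRing R'] [Module k R']
    [AddCommGroup M] [Module k M] [AddCommGroup M'] [Module k M'] where
  bimod : Bimod k R R' M
  bimod' : Bimod k R' R M'
  τ : TensorOver bimod bimod' →ₗ[k] R
  τ' : TensorOver bimod' bimod →ₗ[k] R'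
  τ_left : ∀ r m m', τ (tmulOver bimod bimod' (bimod.left r m) m') =
    r * τ (tmulOver bimod bimod' m m')
  τ_right : ∀ r m m', τ (tmulOver bimod bimod' m (bimod'.right r m')) =
    τ (tmulOver bimod bimod' m m') * r
  τ'_left : ∀ r' m' m, τ' (tmulOver bimod' bimod (bimod'.left r' m') m) =
    r' * τ' (tmulOver bimod' bimod m' m)
  τ'_right : ∀ r' m' m, τ' (tmulOver bimod' bimod m' (bimod.right r' m)) =
    τ' (tmulOver bimod' bimod m' m) * r'
  /-- `τ(m₁ ⊗ m') m₂ = m₁ τ'(m' ⊗ m₂)` -/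
  assoc : ∀ m₁ m' m₂, bimod.left (τ (tmulOver bimod bimod' m₁ m')) m₂ =
    bimod.right (τ' (tmulOver bimod' bimod m' m₂)) m₁
  /-- `τ'(m'₁ ⊗ m) m'₂ = m'₁ τ(m ⊗ m'₂)` -/
  assoc' : ∀ m'₁ m m'₂, bimod'.left (τ' (tmulOver bimod' bimod m'₁ m)) m'₂ =
    bimod'.right (τ (tmulOver bimod bimod' m m'₂)) m'₁

open scoped Classical in
/-- `E` is a set of orthogonal local units of `R`: pairwise orthogonal idempotents with
`R = ⨁_{e ∈ E} R e = ⨁_{e ∈ E} e R`. -/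
structure IsOrthogonalLocalUnits (k : Type*) {R : Type*} [CommRing k]
    [NonUnitalRing R] [Module k R] [IsScalarTower k R R] [SMulCommClass k R R]
    (E : Set R) : Prop where
  idem : ∀ e ∈ E, e * e = e
  orthogonal : ∀ e ∈ E, ∀ f ∈ E, e ≠ f → e * f = 0
  right_internal : DirectSum.IsInternal fun e : E => LinearMap.range (LinearMap.mulRight k (e : R))
  left_internal : DirectSum.IsInternal fun e : E => LinearMap.range (LinearMap.mulLeft k (e : R))

/-- `FMat X R`: the `X × X`-matrices over `R` with only finitely many non-zero entries. -/
def FMat (X R : Type*) [Zero R] : Type _ := (X × X) →₀ R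

namespace FMat

variable {X R : Type*}

/-- The `(i, j)`-entry of a matrix. -/
def entry [Zero R] (A : FMat X R) (i j : X) : R := (show (X × X) →₀ R from A) (i, j)

theorem ext [Zero R] {A B : FMat X R} (h : ∀ i j, A.entry i j = B.entry i j) : A = B :=
  Finsupp.ext fun p => h p.1 p.2

/-- Finitely many indices which contain the row and the column of every non-zero entry. -/
theorem exists_finset [Zero R] (A : FMat X R) :
    ∃ s : Finset X, ∀ i j, A.entry i j ≠ 0 → i ∈ s ∧ j ∈ s := by
  classical
  refine ⟨Finset.image Prod.fst (Finsupp.support A) ∪ Finset.image Prod.snd (Finsupp.support A),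
    fun i j h => ?_⟩
  have h2 : (i, j) ∈ Finsupp.support (show (X × X) →₀ R from A) := Finsupp.mem_support_iff.2 h
  exact ⟨Finset.mem_union_left _ (Finset.mem_image.2 ⟨_, h2, rfl⟩),
    Finset.mem_union_right _ (Finset.mem_image.2 ⟨_, h2, rfl⟩)⟩

/-- A matrix is determined by a function with finite support. -/
noncomputable def ofFun [Zero R] (f : X → X → R) (hf : ({p | f p.1 p.2 ≠ 0} : Set (X × X)).Finite) :
    FMat X R :=
  (Finsupp.ofSupportFinite (fun p : X × X => f p.1 p.2) hf : (X × X) →₀ R)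

@[simp] theorem entry_ofFun [Zero R] (f : X → X → R)
    (hf : ({p | f p.1 p.2 ≠ 0} : Set (X × X)).Finite) (i j : X) : (ofFun f hf).entry i j = f i j :=
  rfl

noncomputable instance [AddCommGroup R] : AddCommGroup (FMat X R) :=
  inferInstanceAs (AddCommGroup ((X × X) →₀ R))

noncomputable instance {k : Type*} [CommRing k] [AddCommGroup R] [Module k R] :
    Module k (FMat X R) :=
  inferInstanceAs (Module k ((X × X) →₀ R))

@[simp] theorem entry_zero [AddCommGroup R] (i j : X) : (0 : FMat X R).entry i j = 0 := rfl

@[simp] theorem entry_add [AddCommGroup R] (A B : FMat X R) (i j : X) :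
    (A + B).entry i j = A.entry i j + B.entry i j := rfl

@[simp] theorem entry_smul {k : Type*} [CommRing k] [AddCommGroup R] [Module k R] (c : k)
    (A : FMat X R) (i j : X) : (c • A).entry i j = c • A.entry i j := rfl

variable [NonUnitalRing R]

theorem finsum_entry_eq {A B : FMat X R} {s : Finset X}
    (hs : ∀ i j, A.entry i j ≠ 0 → i ∈ s ∧ j ∈ s) (i j : X) :
    ∑ᶠ l, A.entry i l * B.entry l j = ∑ l ∈ s, A.entry i l * B.entry l j := by
  refine finsum_eq_sum_of_support_subset _ fun l hl => ?_
  exact (hs i l (left_ne_zero_of_mul hl)).2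

theorem finite_mul (A B : FMat X R) :
    ({p | ∑ᶠ l, A.entry p.1 l * B.entry l p.2 ≠ 0} : Set (X × X)).Finite := by
  obtain ⟨s, hs⟩ := A.exists_finset
  obtain ⟨t, ht⟩ := B.exists_finset
  refine (s ×ˢ t).finite_toSet.subset fun p hp => ?_
  obtain ⟨l, hl⟩ : ∃ l, A.entry p.1 l * B.entry l p.2 ≠ 0 := by
    by_contra! h
    exact hp (by simp [h])
  exact Finset.mem_coe.2 (Finset.mem_product.2
    ⟨(hs _ _ (left_ne_zero_of_mul hl)).1, (ht _ _ (right_ne_zero_of_mul hl)).2⟩)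

/-- Matrix multiplication, `(A B)_{ij} = ∑_l A_{il} B_{lj}` (a finite sum). -/
noncomputable instance : Mul (FMat X R) where
  mul A B := ofFun (fun i j => ∑ᶠ l, A.entry i l * B.entry l j) (finite_mul A B)

theorem entry_mul (A B : FMat X R) (i j : X) :
    (A * B).entry i j = ∑ᶠ l, A.entry i l * B.entry l j := rfl

theorem entry_mul_eq_sum {A : FMat X R} (B : FMat X R) {s : Finset X}
    (hs : ∀ i j, A.entry i j ≠ 0 → i ∈ s ∧ j ∈ s) (i j : X) :
    (A * B).entry i j = ∑ l ∈ s, A.entry i l * B.entry l j := finsum_entry_eq hs i j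

noncomputable instance : NonUnitalRing (FMat X R) where
  left_distrib A B C := by
    obtain ⟨s, hs⟩ := A.exists_finset
    refine ext fun i j => ?_
    simp [entry_mul_eq_sum _ hs, mul_add, Finset.sum_add_distrib]
  right_distrib A B C := by
    classical
    obtain ⟨s, hs⟩ := A.exists_finset
    obtain ⟨t, ht⟩ := B.exists_finset
    have hs1 : ∀ i j, A.entry i j ≠ 0 → i ∈ s ∪ t ∧ j ∈ s ∪ t := fun i j h => by
      have := hs i j h; simp [this]
    have ht1 : ∀ i j, B.entry i j ≠ 0 → i ∈ s ∪ t ∧ j ∈ s ∪ t := fun i j h => by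
      have := ht i j h; simp [this]
    have hst : ∀ i j, (A + B).entry i j ≠ 0 → i ∈ s ∪ t ∧ j ∈ s ∪ t := fun i j h => by
      by_cases hA : A.entry i j = 0
      · exact ht1 i j fun hB => h (by simp [hA, hB])
      · exact hs1 i j hA
    refine ext fun i j => ?_
    simp [entry_mul_eq_sum _ hs1, entry_mul_eq_sum _ ht1, entry_mul_eq_sum _ hst, add_mul,
      Finset.sum_add_distrib]
  zero_mul A := ext fun i j => by simp [entry_mul]
  mul_zero A := ext fun i j => by simp [entry_mul]
  mul_assoc A B C := by
    obtain ⟨s, hs⟩ := A.exists_finset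
    obtain ⟨t, ht⟩ := B.exists_finset
    have h : ∀ i j, (A * B).entry i j ≠ 0 → j ∈ t := fun i j hij => by
      obtain ⟨l, hl⟩ : ∃ l, A.entry i l * B.entry l j ≠ 0 := by
        by_contra! h0
        exact hij (by simp [entry_mul, h0])
      exact (ht _ _ (right_ne_zero_of_mul hl)).2
    refine ext fun i j => ?_
    have h1 : (A * B * C).entry i j = ∑ l ∈ t, (A * B).entry i l * C.entry l j :=
      finsum_eq_sum_of_support_subset _ fun l hl => h i l (left_ne_zero_of_mul hl)
    rw [h1, entry_mul_eq_sum _ hs]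
    simp only [entry_mul_eq_sum _ hs, entry_mul_eq_sum _ ht, Finset.sum_mul, Finset.mul_sum,
      mul_assoc]
    exact Finset.sum_comm

end FMat

end StableMorita

/-! Matrices over `R` act faithfully from the right on row vectors in `R^(X)`, and matrices over
`R'` act faithfully on `M^(X)`. In both cases the image is the span of the operators `x ↦ ⟨x, q⟩ p`,
where `⟨ , ⟩` is the `R`-valued pairing of `R^(X)` with itself, respectively of `M^(X)` with
`M'^(X)` (`FMat.range_rowAct`). This span depends only on the pairing and on the action of `R` on
the left-hand module, so it suffices to show that the two pairings are equivalent
(`Pairing.Equiv.exists_ringEquiv`).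

Writing each local unit as a finite sum of values of `τ` or `τ'` makes `(R, R)` a direct summand of
`(M, M')^(X)` and `(M, M')` a direct summand of `(R, R)^(X)`. The bounds on `|E|` and `|F|` provide
enough copies. An Eilenberg swindle (`Pairing.Retract.absorb`) then yields `R^(X) ≅ M^(X)`,
compatibly with the duals. -/

open scoped TensorProduct

namespace StableMorita

/-! ### Pairings, their direct sums and their equivalences -/

/-- A pairing of `k`-modules `P` and `Q` with values in `R`, where `R` also acts on `P`. -/
structure Pairing (k R P Q : Type*) [CommRing k] [AddCommGroup R] [Module k R]
    [AddCommGroup P] [Module k P] [AddCommGroup Q] [Module k Q] where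
  act : R →ₗ[k] P →ₗ[k] P
  pair : P →ₗ[k] Q →ₗ[k] R

namespace Pairing

variable {k R P Q P' Q' P'' Q'' P₁ Q₁ P₁' Q₁' : Type*} [CommRing k] [AddCommGroup R] [Module k R]
  [AddCommGroup P] [Module k P] [AddCommGroup Q] [Module k Q]
  [AddCommGroup P'] [Module k P'] [AddCommGroup Q'] [Module k Q']
  [AddCommGroup P''] [Module k P''] [AddCommGroup Q''] [Module k Q'']
  [AddCommGroup P₁] [Module k P₁] [AddCommGroup Q₁] [Module k Q₁]
  [AddCommGroup P₁'] [Module k P₁'] [AddCommGroup Q₁'] [Module k Q₁']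

/-- The direct sum of copies of a pairing, indexed by `ι`. -/
noncomputable def finsupp (ι : Type*) (S : Pairing k R P Q) : Pairing k R (ι →₀ P) (ι →₀ Q) where
  act := LinearMap.mk₂ k (fun r x => Finsupp.mapRange.linearMap (S.act r) x)
    (fun _ _ _ => by ext; simp) (fun _ _ _ => by ext; simp) (fun _ _ _ => by ext; simp)
    (fun _ _ _ => by ext; simp)
  pair := Finsupp.lsum k fun i => S.pair.compl₂ (Finsupp.lapply i)

@[simp] theorem finsupp_act_apply {ι : Type*} (S : Pairing k R P Q) (r : R) (x : ι →₀ P) (i : ι) :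
    (S.finsupp ι).act r x i = S.act r (x i) := by
  simp [finsupp]

@[simp] theorem finsupp_act_single {ι : Type*} (S : Pairing k R P Q) (r : R) (i : ι) (p : P) :
    (S.finsupp ι).act r (Finsupp.single i p) = Finsupp.single i (S.act r p) := by
  simp [finsupp]

@[simp] theorem finsupp_pair_single {ι : Type*} (S : Pairing k R P Q) (i : ι) (p : P)
    (y : ι →₀ Q) : (S.finsupp ι).pair (Finsupp.single i p) y = S.pair p (y i) := by
  simp [finsupp]

/-- The pairing on the direct sum is built by recursion on its left argument, so evaluation at a
single vector on the right takes an induction. -/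
theorem finsupp_pair_single_right {ι : Type*} (S : Pairing k R P Q) (x : ι →₀ P) (i : ι) (q : Q) :
    (S.finsupp ι).pair x (Finsupp.single i q) = S.pair (x i) q := by
  classical
  induction x using Finsupp.induction_linear with
  | zero => simp
  | add x y hx hy => simp [hx, hy]
  | single j p =>
    by_cases h : i = j
    · subst h; simp
    · simp [h, Ne.symm h]

/-- The direct sum of two pairings. -/
def prod (S : Pairing k R P Q) (T : Pairing k R P' Q') : Pairing k R (P × P') (Q × Q') where
  act := LinearMap.mk₂ k (fun r x => (S.act r x.1, T.act r x.2))
    (fun _ _ _ => by ext <;> simp) (fun _ _ _ => by ext <;> simp) (fun _ _ _ => by ext <;> simp)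
    (fun _ _ _ => by ext <;> simp)
  pair := S.pair.compl₁₂ (.fst k P P') (.fst k Q Q') + T.pair.compl₁₂ (.snd k P P') (.snd k Q Q')

@[simp] theorem prod_act (S : Pairing k R P Q) (T : Pairing k R P' Q') (r : R) (x : P × P') :
    (S.prod T).act r x = (S.act r x.1, T.act r x.2) := rfl

@[simp] theorem prod_pair (S : Pairing k R P Q) (T : Pairing k R P' Q') (x : P × P')
    (y : Q × Q') : (S.prod T).pair x y = S.pair x.1 y.1 + T.pair x.2 y.2 := rfl

/-- An equivalence of pairings: a pair of isomorphisms which preserve the action and the values. -/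
structure Equiv (S : Pairing k R P Q) (T : Pairing k R P' Q') where
  equiv : P ≃ₗ[k] P'
  dual : Q ≃ₗ[k] Q'
  map_act : ∀ r x, equiv (S.act r x) = T.act r (equiv x)
  map_pair : ∀ x y, T.pair (equiv x) (dual y) = S.pair x y

namespace Equiv

variable {S : Pairing k R P Q} {T : Pairing k R P' Q'} {U : Pairing k R P'' Q''}
  {S₁ : Pairing k R P₁ Q₁} {T₁ : Pairing k R P₁' Q₁'}

def refl (S : Pairing k R P Q) : Equiv S S :=
  ⟨.refl k P, .refl k Q, fun _ _ => rfl, fun _ _ => rfl⟩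

def symm (e : Equiv S T) : Equiv T S where
  equiv := e.equiv.symm
  dual := e.dual.symm
  map_act r x := by rw [LinearEquiv.symm_apply_eq, e.map_act, LinearEquiv.apply_symm_apply]
  map_pair x y := by rw [← e.map_pair, LinearEquiv.apply_symm_apply, LinearEquiv.apply_symm_apply]

def trans (e : Equiv S T) (f : Equiv T U) : Equiv S U where
  equiv := e.equiv.trans f.equiv
  dual := e.dual.trans f.dual
  map_act r x := by simp [e.map_act, f.map_act]
  map_pair x y := by simp [e.map_pair, f.map_pair]

def prodCongr (e : Equiv S T) (f : Equiv S₁ T₁) : Equiv (S.prod S₁) (T.prod T₁) where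
  equiv := e.equiv.prodCongr f.equiv
  dual := e.dual.prodCongr f.dual
  map_act r x := by simp [e.map_act, f.map_act]
  map_pair x y := by simp [e.map_pair, f.map_pair]

def prodComm (S : Pairing k R P Q) (T : Pairing k R P' Q') : Equiv (S.prod T) (T.prod S) where
  equiv := .prodComm k P P'
  dual := .prodComm k Q Q'
  map_act r x := rfl
  map_pair x y := by simp [add_comm]

def prodAssoc (S : Pairing k R P Q) (T : Pairing k R P' Q') (U : Pairing k R P'' Q'') :
    Equiv ((S.prod T).prod U) (S.prod (T.prod U)) where
  equiv := .prodAssoc k P P' P''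
  dual := .prodAssoc k Q Q' Q''
  map_act r x := rfl
  map_pair x y := by simp [add_assoc]

noncomputable def finsuppCongr (ι : Type*) (e : Equiv S T) :
    Equiv (S.finsupp ι) (T.finsupp ι) where
  equiv := Finsupp.mapRange.linearEquiv e.equiv
  dual := Finsupp.mapRange.linearEquiv e.dual
  map_act r x := by ext; simp [e.map_act]
  map_pair x y := by
    induction x using Finsupp.induction_linear with
    | zero => simp only [map_zero, LinearMap.zero_apply]
    | add x₁ x₂ h₁ h₂ => simp only [map_add, LinearMap.add_apply, h₁, h₂]
    | single i p => simp [e.map_pair]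

noncomputable def finsuppDomCongr {ι κ : Type*} (S : Pairing k R P Q) (e : ι ≃ κ) :
    Equiv (S.finsupp ι) (S.finsupp κ) where
  equiv := Finsupp.domLCongr e
  dual := Finsupp.domLCongr e
  map_act r x := by ext; simp
  map_pair x y := by
    induction x using Finsupp.induction_linear with
    | zero => simp only [map_zero, LinearMap.zero_apply]
    | add x₁ x₂ h₁ h₂ => simp only [map_add, LinearMap.add_apply, h₁, h₂]
    | single i p => simp

noncomputable def finsuppCurry (ι κ : Type*) (S : Pairing k R P Q) :
    Equiv (S.finsupp (ι × κ)) ((S.finsupp κ).finsupp ι) where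
  equiv := Finsupp.curryLinearEquiv k
  dual := Finsupp.curryLinearEquiv k
  map_act r x := by ext; simp
  map_pair x y := by
    induction x using Finsupp.induction_linear with
    | zero => simp only [map_zero, LinearMap.zero_apply]
    | add x₁ x₂ h₁ h₂ => simp only [map_add, LinearMap.add_apply, h₁, h₂]
    | single i p => simp

noncomputable def finsuppSum (ι κ : Type*) (S : Pairing k R P Q) :
    Equiv (S.finsupp (ι ⊕ κ)) ((S.finsupp ι).prod (S.finsupp κ)) where
  equiv := Finsupp.sumFinsuppLEquivProdFinsupp k
  dual := Finsupp.sumFinsuppLEquivProdFinsupp k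
  map_act r x := by ext <;> simp
  map_pair x y := by
    induction x using Finsupp.induction_linear with
    | zero => simp only [map_zero, LinearMap.zero_apply]
    | add x₁ x₂ h₁ h₂ => simp only [map_add, LinearMap.add_apply, h₁, h₂]
    | single i p =>
      rcases i with i | i
      · have : Finsupp.sumFinsuppLEquivProdFinsupp k (Finsupp.single (Sum.inl i : ι ⊕ κ) p) =
          (Finsupp.single i p, 0) := by classical ext <;> simp [Finsupp.single_apply]
        simp [this]
      · have : Finsupp.sumFinsuppLEquivProdFinsupp k (Finsupp.single (Sum.inr i : ι ⊕ κ) p) =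
          (0, Finsupp.single i p) := by classical ext <;> simp [Finsupp.single_apply]
        simp [this]

/-- Finitely supported functions with values in a product are pairs of such functions. -/
noncomputable def finsuppProdLEquiv (k ι P P' : Type*) [CommRing k] [AddCommGroup P] [Module k P]
    [AddCommGroup P'] [Module k P'] : (ι →₀ P × P') ≃ₗ[k] (ι →₀ P) × (ι →₀ P') :=
  .ofLinearMap
    ((Finsupp.mapRange.linearMap (.fst k P P')).prod
      (Finsupp.mapRange.linearMap (.snd k P P')))
    ((Finsupp.mapRange.linearMap (.inl k P P')).coprod (Finsupp.mapRange.linearMap (.inr k P P')))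
    (by ext <;> simp) (by ext <;> simp)

noncomputable def finsuppProd (ι : Type*) (S : Pairing k R P Q) (T : Pairing k R P' Q') :
    Equiv ((S.prod T).finsupp ι) ((S.finsupp ι).prod (T.finsupp ι)) where
  equiv := finsuppProdLEquiv k ι P P'
  dual := finsuppProdLEquiv k ι Q Q'
  map_act r x := by ext <;> simp [finsuppProdLEquiv]
  map_pair x y := by
    induction x using Finsupp.induction_linear with
    | zero => simp only [map_zero, LinearMap.zero_apply]
    | add x₁ x₂ h₁ h₂ => simp only [map_add, LinearMap.add_apply, h₁, h₂]
    | single i p => simp [finsuppProdLEquiv]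

end Equiv

/-! ### Direct summands of pairings -/

/-- `S` is a direct summand of `T`, with an inclusion and a projection on both sides. -/
structure Retract (S : Pairing k R P Q) (T : Pairing k R P' Q') where
  incl : P →ₗ[k] P'
  proj : P' →ₗ[k] P
  dualIncl : Q →ₗ[k] Q'
  dualProj : Q' →ₗ[k] Q
  incl_act : ∀ r x, incl (S.act r x) = T.act r (incl x)
  proj_act : ∀ r x, proj (T.act r x) = S.act r (proj x)
  proj_incl : ∀ x, proj (incl x) = x
  dualProj_dualIncl : ∀ y, dualProj (dualIncl y) = y
  -- The adjointness of `incl` with `dualProj` and of `proj` with `dualIncl` makes the splittings of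
  -- the two modules orthogonal to each other.
  pair_incl : ∀ x y, T.pair (incl x) y = S.pair x (dualProj y)
  pair_dualIncl : ∀ x y, T.pair x (dualIncl y) = S.pair (proj x) y

namespace Retract

variable {S : Pairing k R P Q} {T : Pairing k R P' Q'} {U : Pairing k R P'' Q''}

def trans (e : Retract S T) (f : Retract T U) : Retract S U where
  incl := f.incl ∘ₗ e.incl
  proj := e.proj ∘ₗ f.proj
  dualIncl := f.dualIncl ∘ₗ e.dualIncl
  dualProj := e.dualProj ∘ₗ f.dualProj
  incl_act r x := by simp [e.incl_act, f.incl_act]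
  proj_act r x := by simp [e.proj_act, f.proj_act]
  proj_incl x := by simp [e.proj_incl, f.proj_incl]
  dualProj_dualIncl x := by simp [e.dualProj_dualIncl, f.dualProj_dualIncl]
  pair_incl x y := by simp [e.pair_incl, f.pair_incl]
  pair_dualIncl x y := by simp [e.pair_dualIncl, f.pair_dualIncl]

/-- The complement of a direct summand. -/
def compl (e : Retract S T) : Pairing k R (LinearMap.ker e.proj) (LinearMap.ker e.dualProj) where
  act := LinearMap.mk₂ k (fun r x => ⟨T.act r x, by
      rw [LinearMap.mem_ker, e.proj_act, LinearMap.mem_ker.1 x.2, map_zero]⟩)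
    (fun _ _ _ => by ext; simp) (fun _ _ _ => by ext; simp) (fun _ _ _ => by ext; simp)
    (fun _ _ _ => by ext; simp)
  pair := T.pair.compl₁₂ (Submodule.subtype _) (Submodule.subtype _)

/-- A projection with a section splits its domain. -/
def splitting {P P' : Type*} [AddCommGroup P] [Module k P] [AddCommGroup P'] [Module k P']
    (i : P →ₗ[k] P') (p : P' →ₗ[k] P) (h : ∀ x, p (i x) = x) :
    P' ≃ₗ[k] P × LinearMap.ker p where
  toFun x := (p x, ⟨x - i (p x), by simp [h]⟩)
  map_add' x y := by ext <;> simp [add_sub_add_comm]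
  map_smul' c x := by ext <;> simp [smul_sub]
  invFun x := i x.1 + x.2
  left_inv x := by simp
  right_inv x := by ext <;> simp [h]

/-- A direct summand splits off. -/
def equiv (e : Retract S T) : Equiv T (S.prod e.compl) where
  equiv := splitting e.incl e.proj e.proj_incl
  dual := splitting e.dualIncl e.dualProj e.dualProj_dualIncl
  map_act r x := by ext <;> simp [splitting, compl, e.proj_act, e.incl_act]
  -- The cross terms vanish: by adjointness, `incl` pairs to zero with the kernel of `dualProj`, and
  -- the kernel of `proj` with `dualIncl`.
  map_pair x y := by
    simp [splitting, compl, e.pair_incl, e.pair_dualIncl, e.dualProj_dualIncl]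

/-- Extension by zero along `j` is split by restriction along `j`, on both sides of the pairing. -/
noncomputable def finsuppOfEmbedding {ι κ : Type*} (S : Pairing k R P Q) (j : ι ↪ κ) :
    Retract (S.finsupp ι) (S.finsupp κ) where
  incl := Finsupp.lmapDomain P k j
  proj := Finsupp.lcomapDomain j j.injective
  dualIncl := Finsupp.lmapDomain Q k j
  dualProj := Finsupp.lcomapDomain j j.injective
  incl_act r x := by
    induction x using Finsupp.induction_linear with
    | zero => simp only [map_zero]
    | add x₁ x₂ h₁ h₂ => simp only [map_add, h₁, h₂]
    | single i p => simp
  proj_act r x := by ext; simp [Finsupp.lcomapDomain]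
  proj_incl x := Finsupp.leftInverse_lcomapDomain_mapDomain j j.injective x
  dualProj_dualIncl x := Finsupp.leftInverse_lcomapDomain_mapDomain j j.injective x
  pair_incl x y := by
    induction x using Finsupp.induction_linear with
    | zero => simp only [map_zero, LinearMap.zero_apply]
    | add x₁ x₂ h₁ h₂ => simp only [map_add, LinearMap.add_apply, h₁, h₂]
    | single i p => simp [Finsupp.lcomapDomain]
  pair_dualIncl x y := by
    induction y using Finsupp.induction_linear with
    | zero => simp only [map_zero]
    | add x₁ x₂ h₁ h₂ => simp only [map_add, h₁, h₂]
    | single i p => simp [Finsupp.lcomapDomain, finsupp_pair_single_right]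

end Retract

/-! ### The Eilenberg swindle -/

/-- If `S` is a direct summand of a sum of copies of `T`, then it is absorbed by an infinite sum. -/
theorem Retract.absorb {X : Type*} [Infinite X] {S : Pairing k R P Q} {T : Pairing k R P' Q'}
    (e : Retract S (T.finsupp X)) :
    Nonempty (Equiv (T.finsupp X) ((S.finsupp X).prod (T.finsupp X))) := by
  obtain ⟨f⟩ : Nonempty (X × X ≃ X) :=
    Cardinal.eq.1 (by simp [Cardinal.mul_eq_self (Cardinal.aleph0_le_mk X)])
  obtain ⟨g⟩ : Nonempty (X ⊕ X ≃ X) :=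
    Cardinal.eq.1 (by simp [Cardinal.add_eq_self (Cardinal.aleph0_le_mk X)])
  -- With `T^(X) ≅ S ⊕ S'`: `T^(X) ≅ (T^(X))^(X) ≅ S^(X) ⊕ S'^(X)`.
  have a : Equiv (T.finsupp X) ((S.finsupp X).prod (e.compl.finsupp X)) :=
    ((Equiv.finsuppDomCongr T f.symm).trans (Equiv.finsuppCurry X X T)).trans
      ((Equiv.finsuppCongr X e.equiv).trans (Equiv.finsuppProd X _ _))
  have b : Equiv (S.finsupp X) ((S.finsupp X).prod (S.finsupp X)) :=
    (Equiv.finsuppDomCongr S g.symm).trans (Equiv.finsuppSum X X S)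
  -- `T^(X) ≅ S^(X) ⊕ S'^(X) ≅ S^(X) ⊕ (S^(X) ⊕ S'^(X)) ≅ S^(X) ⊕ T^(X)`.
  exact ⟨a.trans ((b.prodCongr (Equiv.refl _)).trans
    ((Equiv.prodAssoc _ _ _).trans ((Equiv.refl _).prodCongr a.symm)))⟩

/-- Direct summands of sums of copies of each other have equivalent infinite sums. -/
theorem nonempty_equiv_finsupp {X : Type*} [Infinite X] {S : Pairing k R P Q}
    {T : Pairing k R P' Q'} (e : Retract S (T.finsupp X)) (f : Retract T (S.finsupp X)) :
    Nonempty (Equiv (S.finsupp X) (T.finsupp X)) := by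
  obtain ⟨a⟩ := e.absorb
  obtain ⟨b⟩ := f.absorb
  -- Both sums are equivalent to `S^(X) ⊕ T^(X)`.
  exact ⟨b.trans ((Equiv.prodComm _ _).trans a.symm)⟩

/-! ### Direct summands from locally finite families -/

/-- A pointwise finite family of linear maps as a linear map to the direct sum. -/
noncomputable def finsuppOfFamily {ι : Type*} (a : ι → P →ₗ[k] P')
    (h : ∀ x, ∃ s : Finset ι, ∀ i ∉ s, a i x = 0) : P →ₗ[k] ι →₀ P' where
  toFun x := Finsupp.ofSupportFinite (fun i => a i x) <| by
    obtain ⟨s, hs⟩ := h x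
    exact s.finite_toSet.subset fun i hi => by_contra fun hn => hi (hs i hn)
  map_add' x y := by ext; simp [Finsupp.ofSupportFinite_coe]
  map_smul' c x := by ext; simp [Finsupp.ofSupportFinite_coe]

@[simp] theorem finsuppOfFamily_apply {ι : Type*} (a : ι → P →ₗ[k] P')
    (h : ∀ x, ∃ s : Finset ι, ∀ i ∉ s, a i x = 0) (x : P) (i : ι) :
    finsuppOfFamily a h x i = a i x := rfl

theorem lsum_finsuppOfFamily {ι : Type*} (a : ι → P →ₗ[k] P') (b : ι → P' →ₗ[k] P)
    (h : ∀ x, ∃ s : Finset ι, ∀ i ∉ s, a i x = 0) {x : P} {s : Finset ι}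
    (hs : ∀ i ∉ s, a i x = 0) (hx : ∑ i ∈ s, b i (a i x) = x) :
    Finsupp.lsum k b (finsuppOfFamily a h x) = x := by
  rw [Finsupp.lsum_apply, Finsupp.sum_of_support_subset _ (s := s)]
  · exact hx
  · exact fun i hi => by_contra fun hn => Finsupp.mem_support_iff.1 hi (hs i hn)
  · simp

/-- A locally finite family of maps which resolves the identity makes a pairing a direct summand of
a direct sum. -/
noncomputable def Retract.ofFamily {ι : Type*} {S : Pairing k R P Q} {T : Pairing k R P' Q'}
    (a : ι → P →ₗ[k] P') (b : ι → P' →ₗ[k] P) (a' : ι → Q →ₗ[k] Q') (b' : ι → Q' →ₗ[k] Q)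
    (a_act : ∀ i r x, a i (S.act r x) = T.act r (a i x))
    (b_act : ∀ i r x, b i (T.act r x) = S.act r (b i x))
    (pair_a : ∀ i x y, T.pair (a i x) y = S.pair x (b' i y))
    (pair_a' : ∀ i x y, T.pair x (a' i y) = S.pair (b i x) y)
    (h : ∀ x, ∃ s : Finset ι, (∀ i ∉ s, a i x = 0) ∧ ∑ i ∈ s, b i (a i x) = x)
    (h' : ∀ y, ∃ s : Finset ι, (∀ i ∉ s, a' i y = 0) ∧ ∑ i ∈ s, b' i (a' i y) = y) :
    Retract S (T.finsupp ι) where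
  incl := finsuppOfFamily a fun x => (h x).imp fun _ => And.left
  proj := Finsupp.lsum k b
  dualIncl := finsuppOfFamily a' fun y => (h' y).imp fun _ => And.left
  dualProj := Finsupp.lsum k b'
  incl_act r x := by ext; simp [a_act]
  proj_act r x := by
    induction x using Finsupp.induction_linear with
    | zero => simp only [map_zero]
    | add x₁ x₂ h₁ h₂ => simp only [map_add, h₁, h₂]
    | single i p => simp [b_act]
  proj_incl x := by
    obtain ⟨s, hs, hx⟩ := h x
    exact lsum_finsuppOfFamily a b _ hs hx
  dualProj_dualIncl y := by
    obtain ⟨s, hs, hy⟩ := h' y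
    exact lsum_finsuppOfFamily a' b' _ hs hy
  pair_incl x y := by
    induction y using Finsupp.induction_linear with
    | zero => simp only [map_zero]
    | add x₁ x₂ h₁ h₂ => simp only [map_add, h₁, h₂]
    | single i p => simp [finsupp_pair_single_right, pair_a]
  pair_dualIncl x y := by
    induction x using Finsupp.induction_linear with
    | zero => simp only [map_zero, LinearMap.zero_apply]
    | add x₁ x₂ h₁ h₂ => simp only [map_add, LinearMap.add_apply, h₁, h₂]
    | single i p => simp [pair_a']

end Pairing
end StableMorita

/-! ### Finite rank operators of a pairing -/

namespace StableMorita

namespace Pairing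

variable {k R P Q P' Q' : Type*} [CommRing k] [AddCommGroup R] [Module k R]
  [AddCommGroup P] [Module k P] [AddCommGroup Q] [Module k Q]
  [AddCommGroup P'] [Module k P'] [AddCommGroup Q'] [Module k Q']

/-- The operator `x ↦ ⟨x, q⟩ p`. -/
def rankOne (S : Pairing k R P Q) : Q →ₗ[k] P →ₗ[k] Module.End k P :=
  LinearMap.mk₂ k (fun q p => S.act.flip p ∘ₗ S.pair.flip q)
    (fun _ _ _ => by ext; simp) (fun _ _ _ => by ext; simp) (fun _ _ _ => by ext; simp)
    (fun _ _ _ => by ext; simp)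

@[simp] theorem rankOne_apply (S : Pairing k R P Q) (q : Q) (p x : P) :
    S.rankOne q p x = S.act (S.pair x q) p := rfl

/-- The operators of finite rank. -/
def finiteRank (S : Pairing k R P Q) : Submodule k (Module.End k P) :=
  Submodule.span k {f | ∃ q p, S.rankOne q p = f}

theorem Equiv.conj_rankOne {S : Pairing k R P Q} {T : Pairing k R P' Q'} (e : Equiv S T)
    (q : Q) (p : P) : e.equiv.conj (S.rankOne q p) = T.rankOne (e.dual q) (e.equiv p) := by
  ext x
  obtain ⟨x, rfl⟩ := e.equiv.surjective x
  simp [LinearEquiv.conj_apply, e.map_act, e.map_pair]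

theorem Equiv.map_finiteRank {S : Pairing k R P Q} {T : Pairing k R P' Q'} (e : Equiv S T) :
    S.finiteRank.map (e.equiv.conj : Module.End k P →ₗ[k] Module.End k P') = T.finiteRank := by
  rw [finiteRank, Submodule.map_span, finiteRank]
  congr 1
  ext f
  constructor
  · rintro ⟨_, ⟨q, p, rfl⟩, rfl⟩
    exact ⟨_, _, (e.conj_rankOne q p).symm⟩
  · rintro ⟨q, p, rfl⟩
    exact ⟨_, ⟨e.dual.symm q, e.equiv.symm p, rfl⟩, (e.conj_rankOne _ _).trans (by simp)⟩

/-- Algebras which act faithfully from the right as the finite rank operators of equivalent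
pairings are isomorphic. -/
theorem Equiv.exists_ringEquiv {A B : Type*} [NonUnitalRing A] [Module k A] [NonUnitalRing B]
    [Module k B] {S : Pairing k R P Q} {T : Pairing k R P' Q'} (e : Equiv S T)
    (ρ : A →ₗ[k] Module.End k P) (σ : B →ₗ[k] Module.End k P')
    (hρ : Function.Injective ρ) (hσ : Function.Injective σ)
    (ρ_mul : ∀ a b, ρ (a * b) = ρ b * ρ a) (σ_mul : ∀ a b, σ (a * b) = σ b * σ a)
    (range_ρ : LinearMap.range ρ = S.finiteRank) (range_σ : LinearMap.range σ = T.finiteRank) :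
    ∃ φ : A ≃+* B, ∀ (c : k) (a : A), φ (c • a) = c • φ a := by
  let φ : A ≃ₗ[k] B := (LinearEquiv.ofInjective ρ hρ).trans <|
    (e.equiv.conj.submoduleMap _).trans <|
    (LinearEquiv.ofEq _ _ (by rw [range_ρ, range_σ, ← e.map_finiteRank])).trans
    (LinearEquiv.ofInjective σ hσ).symm
  have key : ∀ a, σ (φ a) = e.equiv.conj (ρ a) := fun a => by
    rw [← LinearEquiv.ofInjective_apply σ (h := hσ)]
    simp [φ]
  refine ⟨{ φ with map_mul' := fun a b => hσ ?_ }, φ.map_smul⟩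
  change σ (φ (a * b)) = σ (φ a * φ b)
  -- Both representations reverse products, so the two reversals cancel.
  rw [σ_mul, key, key, key, ρ_mul]
  ext x
  simp [LinearEquiv.conj_apply]

end Pairing

/-! ### Matrices as finite rank operators on row vectors -/

namespace FMat

variable {k X B P Q R : Type*} [CommRing k] [NonUnitalRing B] [Module k B]
  [AddCommGroup P] [Module k P] [AddCommGroup Q] [Module k Q] [AddCommGroup R] [Module k R]

/-- The matrix with `(i, j)`-entry `b` and zeros elsewhere. -/
noncomputable def single (i j : X) (b : B) : FMat X B := (Finsupp.single (i, j) b : X × X →₀ B)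

open scoped Classical in
theorem entry_single (i j i' j' : X) (b : B) :
    (single i j b).entry i' j' = if i = i' ∧ j = j' then b else 0 := by
  refine (Finsupp.single_apply (a := (i, j)) (a' := (i', j')) (b := b)).trans ?_
  simp only [Prod.mk.injEq]

theorem induction_single {motive : FMat X B → Prop} (A : FMat X B) (zero : motive 0)
    (add : ∀ A A', motive A → motive A' → motive (A + A'))
    (single : ∀ i j b, motive (single i j b)) : motive A :=
  Finsupp.induction_linear (motive := motive) (show X × X →₀ B from A) zero
    (fun _ _ => add _ _) fun p b => single p.1 p.2 b

theorem single_mul_single_same (i j l : X) (a b : B) :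
    single i j a * single j l b = single i l (a * b) := by
  refine ext fun i' l' => ?_
  rw [entry_mul, finsum_eq_single _ j]
  · by_cases hi : i = i' <;> by_cases hl : l = l' <;> simp [entry_single, hi, hl]
  · intro j' hj
    simp [entry_single, Ne.symm hj]

theorem single_mul_single_of_ne {j j' : X} (h : j ≠ j') (i l : X) (a b : B) :
    single i j a * single j' l b = 0 := by
  refine ext fun i' l' => ?_
  rw [entry_mul, entry_zero]
  refine finsum_eq_zero_of_forall_eq_zero fun m => ?_
  by_cases hj : j = m
  · subst hj; simp [entry_single, Ne.symm h]
  · simp [entry_single, hj]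

/-- The right action of matrices over `B` on row vectors over a right `B`-module. -/
noncomputable def rowAct (ρ : B →ₗ[k] P →ₗ[k] P) : FMat X B →ₗ[k] Module.End k (X →₀ P) :=
  (Finsupp.lsum k fun p : X × X => LinearMap.mk₂ k (fun b x => Finsupp.single p.2 (ρ b (x p.1)))
    (by simp) (by simp) (by simp) (by simp) :
    (X × X →₀ B) →ₗ[k] Module.End k (X →₀ P))

@[simp] theorem rowAct_single (ρ : B →ₗ[k] P →ₗ[k] P) (i j : X) (b : B) (x : X →₀ P) :
    rowAct ρ (single i j b) x = Finsupp.single j (ρ b (x i)) := by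
  have : rowAct ρ (single i j b) = LinearMap.mk₂ k
      (fun (b : B) (x : X →₀ P) => Finsupp.single j (ρ b (x i)))
      (by simp) (by simp) (by simp) (by simp) b :=
    Finsupp.lsum_single k _ (i, j) b
  rw [this, LinearMap.mk₂_apply]

/-- The action is from the right, hence the reversed order. Additivity in both factors reduces the
claim to matrices with one non-zero entry. -/
theorem rowAct_mul {ρ : B →ₗ[k] P →ₗ[k] P} (hρ : ∀ a b x, ρ (a * b) x = ρ b (ρ a x))
    (A A' : FMat X B) : rowAct ρ (A * A') = rowAct ρ A' * rowAct ρ A := by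
  induction A using induction_single with
  | zero => simp
  | add A₁ A₂ h₁ h₂ => rw [add_mul, map_add, h₁, h₂, map_add, mul_add]
  | single i j a =>
    induction A' using induction_single with
    | zero => simp
    | add A₁ A₂ h₁ h₂ => rw [mul_add, map_add, h₁, h₂, map_add, add_mul]
    | single j' l b =>
      refine LinearMap.ext fun x => ?_
      by_cases h : j = j'
      · subst h
        simp [single_mul_single_same, hρ]
      · simp [single_mul_single_of_ne h, h]

theorem rowAct_apply_single (ρ : B →ₗ[k] P →ₗ[k] P) (A : FMat X B) (i j : X) (p : P) :
    rowAct ρ A (Finsupp.single i p) j = ρ (A.entry i j) p := by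
  classical
  induction A using induction_single with
  | zero => simp
  | add A₁ A₂ h₁ h₂ => simp [h₁, h₂]
  | single i' j' a =>
    by_cases hi : i = i' <;> by_cases hj : j' = j <;>
      simp [entry_single, hi, hj, eq_comm]

theorem rowAct_injective {ρ : B →ₗ[k] P →ₗ[k] P} (hρ : ∀ b, (∀ x, ρ b x = 0) → b = 0) :
    Function.Injective (rowAct (X := X) ρ) := by
  refine (injective_iff_map_eq_zero _).2 fun A hA => ext fun i j => hρ _ fun x => ?_
  rw [← rowAct_apply_single, hA]
  simp

/-- A matrix whose only entry is `δ q p`, at `(i, j)`, acts as the rank one operator of `q` at `i`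
and `p` at `j`. Such matrices span because the values of `δ` do, and such operators span all finite
rank operators. -/
theorem range_rowAct {ρ : B →ₗ[k] P →ₗ[k] P} {S : Pairing k R P Q} (δ : Q → P → B)
    (hδ : ∀ q p x, ρ (δ q p) x = S.act (S.pair x q) p)
    (span_δ : Submodule.span k {b | ∃ q p, δ q p = b} = ⊤) :
    LinearMap.range (rowAct (X := X) ρ) = (S.finsupp X).finiteRank := by
  have rankOne_single (i j : X) (q : Q) (p : P) : rowAct ρ (single i j (δ q p)) =
      (S.finsupp X).rankOne (Finsupp.single i q) (Finsupp.single j p) := by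
    refine LinearMap.ext fun x => ?_
    simp [hδ, Pairing.finsupp_pair_single_right]
  apply le_antisymm
  · rintro _ ⟨A, rfl⟩
    induction A using induction_single with
    | zero => simp
    | add A₁ A₂ h₁ h₂ => rw [map_add]; exact add_mem h₁ h₂
    | single i j b =>
      have hb : b ∈ Submodule.span k {b | ∃ q p, δ q p = b} := span_δ ▸ Submodule.mem_top
      let f : B →ₗ[k] Module.End k (X →₀ P) :=
        rowAct ρ ∘ₗ (Finsupp.lsingle (i, j) : B →ₗ[k] X × X →₀ B)
      refine Submodule.span_le (p := (S.finsupp X).finiteRank.comap f).2 ?_ hb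
      rintro _ ⟨q, p, rfl⟩
      exact Submodule.subset_span ⟨_, _, (rankOne_single i j q p).symm⟩
  · refine Submodule.span_le.2 ?_
    rintro _ ⟨q, p, rfl⟩
    induction q using Finsupp.induction_linear with
    | zero => simp
    | add q₁ q₂ h₁ h₂ => rw [map_add, LinearMap.add_apply]; exact add_mem h₁ h₂
    | single i q =>
      induction p using Finsupp.induction_linear with
      | zero => simp
      | add p₁ p₂ h₁ h₂ => rw [map_add]; exact add_mem h₁ h₂
      | single j p => exact ⟨_, rankOne_single i j q p⟩

end FMat
end StableMorita

/-! ### Resolutions of the identity and orthogonal local units -/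

namespace StableMorita

section Resolution

variable {k ι M N : Type*} [CommRing k] [AddCommGroup M] [Module k M]

/-- The elements on which only finitely many of the `T i` do not vanish, with sum the element. -/
def resolved (T : ι → M →ₗ[k] M) : Submodule k M where
  carrier := {x | ∃ s : Finset ι, (∀ i ∉ s, T i x = 0) ∧ ∑ i ∈ s, T i x = x}
  zero_mem' := ⟨∅, by simp⟩
  add_mem' := by
    classical
    rintro x y ⟨s, hs, hx⟩ ⟨t, ht, hy⟩
    refine ⟨s ∪ t, fun i hi => ?_, ?_⟩
    · rw [Finset.mem_union, not_or] at hi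
      rw [map_add, hs i hi.1, ht i hi.2, add_zero]
    · simp_rw [map_add, Finset.sum_add_distrib]
      rw [← Finset.sum_subset Finset.subset_union_left fun i _ hi => hs i hi,
        ← Finset.sum_subset Finset.subset_union_right fun i _ hi => ht i hi, hx, hy]
  smul_mem' := by
    rintro c x ⟨s, hs, hx⟩
    exact ⟨s, fun i hi => by rw [map_smul, hs i hi, smul_zero], by
      simp_rw [map_smul, ← Finset.smul_sum, hx]⟩

theorem mem_resolved {T : ι → M →ₗ[k] M} {x : M} :
    x ∈ resolved T ↔ ∃ s : Finset ι, (∀ i ∉ s, T i x = 0) ∧ ∑ i ∈ s, T i x = x := Iff.rfl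

/-- The products `ρ b m` generate the module, and on each of them the finite resolution of `b` is
also one of `ρ b m`. This transfers local units from an algebra to its unital modules. -/
theorem resolved_eq_top_of_action {B : Type*} [AddCommGroup B] [Module k B]
    {D : ι → B →ₗ[k] B} {T : ι → M →ₗ[k] M} (ρ : B →ₗ[k] M →ₗ[k] M)
    (h : ∀ i b m, T i (ρ b m) = ρ (D i b) m) (hD : resolved D = ⊤)
    (hρ : AddSubgroup.closure {x : M | ∃ b m, ρ b m = x} = ⊤) : resolved T = ⊤ := by
  refine eq_top_iff.2 fun x _ => ?_
  have hx : x ∈ AddSubgroup.closure {x : M | ∃ b m, ρ b m = x} := hρ ▸ AddSubgroup.mem_top x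
  refine (AddSubgroup.closure_le (resolved T).toAddSubgroup).2 ?_ hx
  rintro _ ⟨b, m, rfl⟩
  obtain ⟨s, hs, hb⟩ := mem_resolved.1 (hD ▸ Submodule.mem_top : b ∈ resolved D)
  refine ⟨s, fun i hi => by rw [h, hs i hi, map_zero, LinearMap.zero_apply], ?_⟩
  simp_rw [h]
  rw [← LinearMap.sum_apply, ← map_sum, hb]

/-- A resolution of the identity, refined by factorizations of its members. -/
theorem exists_finset_sigma {T : ι → M →ₗ[k] M} (hT : resolved T = ⊤) {N : Type*} [Zero N]
    {κ : ι → Type*}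
    [∀ i, Fintype (κ i)] {a : (Σ i, κ i) → M → N} {b : (Σ i, κ i) → N → M}
    (ha : ∀ i j x, T i x = 0 → a ⟨i, j⟩ x = 0) (hab : ∀ i x, ∑ j, b ⟨i, j⟩ (a ⟨i, j⟩ x) = T i x)
    (x : M) : ∃ s : Finset (Σ i, κ i), (∀ i ∉ s, a i x = 0) ∧ ∑ i ∈ s, b i (a i x) = x := by
  obtain ⟨s, hs, hx⟩ := mem_resolved.1 (hT ▸ Submodule.mem_top : x ∈ resolved T)
  refine ⟨s.sigma fun _ => Finset.univ, fun ⟨i, j⟩ hi => ha i j x (hs i ?_), ?_⟩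
  · simpa using hi
  · rw [Finset.sum_sigma]
    simp_rw [hab, hx]

end Resolution

namespace IsOrthogonalLocalUnits

variable {k R : Type*} [CommRing k] [NonUnitalRing R] [Module k R] [IsScalarTower k R R]
  [SMulCommClass k R R] {E : Set R}

/-- On the summand `R e`, right multiplication by `e` is the identity and by every other member of
`E` is zero. The resolved elements form a submodule, so they contain the sum of all `R e`. -/
theorem resolved_mulRight (hE : IsOrthogonalLocalUnits k E) :
    resolved (fun e : E => LinearMap.mulRight k (e : R)) = ⊤ := by
  classical
  rw [eq_top_iff, ← hE.right_internal.submodule_iSup_eq_top, iSup_le_iff]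
  rintro e _ ⟨r, rfl⟩
  refine ⟨{e}, fun f hf => ?_, ?_⟩
  · rw [Finset.mem_singleton] at hf
    simp [mul_assoc, hE.orthogonal e e.2 f f.2 fun h => hf (Subtype.ext h.symm)]
  · simp [mul_assoc, hE.idem e e.2]

theorem resolved_mulLeft (hE : IsOrthogonalLocalUnits k E) :
    resolved (fun e : E => LinearMap.mulLeft k (e : R)) = ⊤ := by
  classical
  rw [eq_top_iff, ← hE.left_internal.submodule_iSup_eq_top, iSup_le_iff]
  rintro e _ ⟨r, rfl⟩
  refine ⟨{e}, fun f hf => ?_, ?_⟩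
  · rw [Finset.mem_singleton] at hf
    simp [← mul_assoc, hE.orthogonal f f.2 e e.2 fun h => hf (Subtype.ext h)]
  · simp [← mul_assoc, hE.idem e e.2]

theorem eq_zero_of_forall_mul (hE : IsOrthogonalLocalUnits k E) {r : R} (h : ∀ x, x * r = 0) :
    r = 0 := by
  obtain ⟨s, -, hr⟩ := mem_resolved.1 (hE.resolved_mulLeft ▸ Submodule.mem_top :
    r ∈ resolved fun e : E => LinearMap.mulLeft k (e : R))
  rw [← hr]
  exact Finset.sum_eq_zero fun e _ => h e

theorem span_mul (hE : IsOrthogonalLocalUnits k E) :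
    Submodule.span k {r : R | ∃ a b, a * b = r} = ⊤ := by
  refine eq_top_iff.2 fun r _ => ?_
  obtain ⟨s, -, hr⟩ := mem_resolved.1 (hE.resolved_mulLeft ▸ Submodule.mem_top :
    r ∈ resolved fun e : E => LinearMap.mulLeft k (e : R))
  rw [← hr]
  exact Submodule.sum_mem _ fun e _ => Submodule.subset_span ⟨e, r, rfl⟩

end IsOrthogonalLocalUnits

/-- The multiplication of an algebra as a pairing. -/
def Pairing.regular (k R : Type*) [CommRing k] [NonUnitalRing R] [Module k R]
    [IsScalarTower k R R] [SMulCommClass k R R] : Pairing k R R R :=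
  ⟨LinearMap.mul k R, LinearMap.mul k R⟩

/-- The fibres are finite, so the sum embeds into `X × ℕ`, hence into `X × X ≃ X`. -/
theorem nonempty_embedding_sigma {ι X : Type*} [Infinite X] (j : Nonempty (ι ↪ X)) (n : ι → ℕ) :
    Nonempty ((Σ i, Fin (n i)) ↪ X) := by
  obtain ⟨j⟩ := j
  obtain ⟨f⟩ : Nonempty (X × X ≃ X) :=
    Cardinal.eq.1 (by simp [Cardinal.mul_eq_self (Cardinal.aleph0_le_mk X)])
  refine ⟨⟨fun p => f (j p.1, Infinite.natEmbedding X p.2), ?_⟩⟩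
  rintro ⟨a, i⟩ ⟨b, l⟩ h
  simp only [EmbeddingLike.apply_eq_iff_eq, Prod.mk.injEq] at h
  obtain ⟨rfl, h⟩ := h
  rw [Fin.val_inj] at h
  rw [h]

/-! ### Direct summands from a Morita context -/

namespace MoritaContext

variable {k R R' M M' : Type*} [CommRing k]
  [NonUnitalRing R] [Module k R] [NonUnitalRing R'] [Module k R']
  [AddCommGroup M] [Module k M] [AddCommGroup M'] [Module k M']

/-- The bilinear map `(m, m') ↦ τ(m ⊗ m')`. -/
def pair (C : MoritaContext k R R' M M') : M →ₗ[k] M' →ₗ[k] R :=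
  (TensorProduct.mk k M M').compr₂ (C.τ ∘ₗ (balancing C.bimod C.bimod').mkQ)

/-- The context with the roles of the two algebras exchanged. -/
def swap (C : MoritaContext k R R' M M') : MoritaContext k R' R M' M where
  bimod := C.bimod'
  bimod' := C.bimod
  τ := C.τ'
  τ' := C.τ
  τ_left := C.τ'_left
  τ_right := C.τ'_right
  τ'_left := C.τ_left
  τ'_right := C.τ_right
  assoc := C.assoc'
  assoc' := C.assoc

variable (C : MoritaContext k R R' M M')

theorem pair_left (r : R) (m : M) (m' : M') :
    C.pair (C.bimod.left r m) m' = r * C.pair m m' := C.τ_left r m m'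

theorem pair_right (r : R) (m : M) (m' : M') :
    C.pair m (C.bimod'.right r m') = C.pair m m' * r := C.τ_right r m m'

theorem pair_balanced (b : R') (m : M) (m' : M') :
    C.pair (C.bimod.right b m) m' = C.pair m (C.bimod'.left b m') :=
  congrArg C.τ ((Submodule.Quotient.eq _).2 (Submodule.subset_span ⟨m, b, m', rfl⟩))

theorem left_pair (m₁ : M) (m' : M') (m₂ : M) :
    C.bimod.left (C.pair m₁ m') m₂ = C.bimod.right (C.swap.pair m' m₂) m₁ := C.assoc m₁ m' m₂

theorem left_swap_pair (m₁ : M') (m : M) (m₂ : M') :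
    C.bimod'.left (C.swap.pair m₁ m) m₂ = C.bimod'.right (C.pair m m₂) m₁ := C.assoc' m₁ m m₂

theorem exists_sum_pair (hτ : Function.Surjective C.τ) (r : R) :
    ∃ (n : ℕ) (v : Fin n → M) (u : Fin n → M'), ∑ i, C.pair (v i) (u i) = r := by
  obtain ⟨t, rfl⟩ := hτ r
  obtain ⟨t, rfl⟩ := Submodule.mkQ_surjective _ t
  obtain ⟨S, rfl⟩ := TensorProduct.exists_finset t
  refine ⟨S.card, fun i => (S.equivFin.symm i).1.1, fun i => (S.equivFin.symm i).1.2, ?_⟩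
  rw [S.equivFin.symm.sum_comp fun p : S => C.pair p.1.1 p.1.2,
    S.sum_coe_sort fun p => C.pair p.1 p.2, map_sum, map_sum]
  rfl

theorem span_pair (hτ : Function.Surjective C.τ) :
    Submodule.span k {r | ∃ m m', C.pair m m' = r} = ⊤ := by
  refine eq_top_iff.2 fun r _ => ?_
  obtain ⟨n, v, u, rfl⟩ := C.exists_sum_pair hτ r
  exact Submodule.sum_mem _ fun i _ => Submodule.subset_span ⟨_, _, rfl⟩

/-- Replacing `v i` by `e (v i)` and `u i` by `(u i) e` turns the sum `e` into `e e e = e`. The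
normalization makes the families of maps built from `v` and `u` locally finite. -/
theorem exists_sum_pair_of_idempotent (hτ : Function.Surjective C.τ) {e : R} (he : e * e = e) :
    ∃ (n : ℕ) (v : Fin n → M) (u : Fin n → M'), ∑ i, C.pair (v i) (u i) = e ∧
      (∀ i, C.bimod.left e (v i) = v i) ∧ ∀ i, C.bimod'.right e (u i) = u i := by
  obtain ⟨n, v, u, h⟩ := C.exists_sum_pair hτ e
  refine ⟨n, fun i => C.bimod.left e (v i), fun i => C.bimod'.right e (u i), ?_, ?_, ?_⟩
  · simp_rw [pair_left, pair_right, ← Finset.mul_sum, ← Finset.sum_mul, h, he]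
  · exact fun i => by rw [← C.bimod.left_mul, he]
  · exact fun i => by rw [← C.bimod'.right_mul, he]

/-- The pairing of the two bimodules of a context. -/
def pairing : Pairing k R M M' := ⟨C.bimod.left, C.pair⟩

variable {E : Set R} {F : Set R'} {X : Type*}

/-- The bimodules of a context are a direct summand of a sum of copies of the algebra. -/
theorem nonempty_retract_regular [IsScalarTower k R R] [SMulCommClass k R R]
    [IsScalarTower k R' R'] [SMulCommClass k R' R']
    (hF : IsOrthogonalLocalUnits k F) [Infinite X] (hFX : Nonempty (F ↪ X))
    (hM : C.bimod.IsUnital) (hM' : C.bimod'.IsUnital) (hτ' : Function.Surjective C.τ') :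
    Nonempty (Pairing.Retract C.pairing ((Pairing.regular k R).finsupp X)) := by
  -- For each `f` in `F`: `∑ τ'(u ⊗ v) = f` with `f u = u` and `v f = v`. The maps `m ↦ τ(m ⊗ u)`
  -- and `r ↦ r v` compose and sum to `m ↦ ∑ τ(m ⊗ u) v = m f`; dually, `m' ↦ τ(v ⊗ m')` and `r ↦ u
  -- r` give `m' ↦ f m'`.
  choose n u v huv hu hv using fun f : F =>
    C.swap.exists_sum_pair_of_idempotent hτ' (hF.idem f f.2)
  have hT : resolved (fun f : F => C.bimod.right f) = ⊤ :=
    resolved_eq_top_of_action C.bimod.right (fun f b m => (C.bimod.right_mul b f m).symm)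
      hF.resolved_mulRight hM.right_unital
  have hT' : resolved (fun f : F => C.bimod'.left f) = ⊤ :=
    resolved_eq_top_of_action C.bimod'.left (fun f b m => (C.bimod'.left_mul f b m).symm)
      hF.resolved_mulLeft hM'.left_unital
  obtain ⟨j⟩ := nonempty_embedding_sigma hFX n
  refine ⟨(Pairing.Retract.ofFamily (ι := Σ f, Fin (n f)) (fun p => C.pair.flip (u p.1 p.2))
    (fun p => C.bimod.left.flip (v p.1 p.2)) (fun p => C.pair (v p.1 p.2))
    (fun p => C.bimod'.right.flip (u p.1 p.2)) ?_ ?_ ?_ ?_ ?_ ?_).trans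
    (Pairing.Retract.finsuppOfEmbedding _ j)⟩
  · exact fun p r m => C.pair_left r m _
  · exact fun p r s => C.bimod.left_mul r s _
  · exact fun p m r => (C.pair_right r m _).symm
  · exact fun p r m' => (C.pair_left r _ m').symm
  · refine exists_finset_sigma hT (fun f i m hm => ?_) fun f m => ?_
    -- If `m f = 0`, then `τ(m ⊗ u) = τ(m ⊗ f u) = τ(m f ⊗ u) = 0`.
    · rw [LinearMap.flip_apply, ← hu]
      exact (C.pair_balanced f m _).symm.trans (by rw [hm, map_zero, LinearMap.zero_apply])
    · simp only [LinearMap.flip_apply, left_pair]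
      rw [← LinearMap.sum_apply, ← map_sum, huv]
  · refine exists_finset_sigma hT' (fun f i m hm => ?_) fun f m => ?_
    · rw [← hv]
      exact (C.pair_balanced f _ m).trans (by rw [hm, map_zero])
    · simp only [LinearMap.flip_apply, ← left_swap_pair]
      rw [← LinearMap.sum_apply, ← map_sum, huv]

/-- An algebra is a direct summand of a sum of copies of the bimodules of a context. -/
theorem nonempty_regular_retract [IsScalarTower k R R] [SMulCommClass k R R]
    (hE : IsOrthogonalLocalUnits k E) [Infinite X] (hEX : Nonempty (E ↪ X))
    (hτ : Function.Surjective C.τ) :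
    Nonempty (Pairing.Retract (Pairing.regular k R) (C.pairing.finsupp X)) := by
  -- Here `∑ τ(v ⊗ u) = e` with `e v = v` and `u e = u`, and the same two kinds of maps are composed
  -- in the other order: `∑ τ(r v ⊗ u) = r e`, and dually `∑ τ(v ⊗ u r) = e r`.
  choose n v u huv hv hu using fun e : E =>
    C.exists_sum_pair_of_idempotent hτ (hE.idem e e.2)
  obtain ⟨j⟩ := nonempty_embedding_sigma hEX n
  refine ⟨(Pairing.Retract.ofFamily (ι := Σ f, Fin (n f))
    (fun p => C.bimod.left.flip (v p.1 p.2)) (fun p => C.pair.flip (u p.1 p.2))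
    (fun p => C.bimod'.right.flip (u p.1 p.2)) (fun p => C.pair (v p.1 p.2))
    ?_ ?_ ?_ ?_ ?_ ?_).trans (Pairing.Retract.finsuppOfEmbedding _ j)⟩
  · exact fun p r s => C.bimod.left_mul r s _
  · exact fun p r m => C.pair_left r m _
  · exact fun p r m' => C.pair_left r _ m'
  · exact fun p m r => C.pair_right r m _
  · refine exists_finset_sigma hE.resolved_mulRight (fun e i r hr => ?_) fun e r => ?_
    · rw [LinearMap.flip_apply, ← hv, ← C.bimod.left_mul]
      exact (congrArg (C.bimod.left · _) hr).trans (by simp)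
    · simp only [LinearMap.flip_apply, pair_left]
      rw [← Finset.mul_sum, huv, LinearMap.mulRight_apply]
  · refine exists_finset_sigma hE.resolved_mulLeft (fun e i r hr => ?_) fun e r => ?_
    · rw [LinearMap.flip_apply, ← hu, ← C.bimod'.right_mul]
      exact (congrArg (C.bimod'.right · _) hr).trans (by simp)
    · simp only [LinearMap.flip_apply, pair_right]
      rw [← Finset.sum_mul, huv, LinearMap.mulLeft_apply]

/-- If `M s = 0`, then `τ'(m' ⊗ m) s = τ'(m' ⊗ m s) = 0`. Since `τ'` is surjective, `R' s = 0`, and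
local units force `s = 0`. -/
theorem eq_zero_of_forall_right [IsScalarTower k R' R'] [SMulCommClass k R' R']
    (hF : IsOrthogonalLocalUnits k F) (hτ' : Function.Surjective C.τ')
    {s : R'} (h : ∀ m, C.bimod.right s m = 0) : s = 0 := by
  refine hF.eq_zero_of_forall_mul fun x => ?_
  obtain ⟨n, u, v, rfl⟩ := C.swap.exists_sum_pair hτ' x
  rw [Finset.sum_mul]
  exact Finset.sum_eq_zero fun i _ => by
    rw [← C.swap.pair_right, show C.swap.bimod'.right s (v i) = 0 from h _, map_zero]

end MoritaContext
end StableMorita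

theorem corollary7p1 {k R R' M M' X : Type*} [CommRing k]
    [NonUnitalRing R] [Module k R] [IsScalarTower k R R] [SMulCommClass k R R]
    [NonUnitalRing R'] [Module k R'] [IsScalarTower k R' R'] [SMulCommClass k R' R']
    [AddCommGroup M] [Module k M] [AddCommGroup M'] [Module k M']
    (E : Set R) (F : Set R')
    (hE : StableMorita.IsOrthogonalLocalUnits k E) (hF : StableMorita.IsOrthogonalLocalUnits k F)
    [Infinite X]
    (hEX : Nonempty (E ↪ X)) (hFX : Nonempty (F ↪ X))
    (C : StableMorita.MoritaContext k R R' M M')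
    (hM : C.bimod.IsUnital) (hM' : C.bimod'.IsUnital)
    (hτ : Function.Surjective C.τ) (hτ' : Function.Surjective C.τ') :
    ∃ φ : StableMorita.FMat X R ≃+* StableMorita.FMat X R',
      ∀ (c : k) (A : StableMorita.FMat X R), φ (c • A) = c • φ A := by
  open StableMorita in
  obtain ⟨f⟩ := C.nonempty_regular_retract hE hEX hτ
  obtain ⟨g⟩ := C.nonempty_retract_regular hF hFX hM hM' hτ'
  obtain ⟨e⟩ := Pairing.nonempty_equiv_finsupp f g
  -- `R` acts on itself by right multiplication and `R'` acts on `M` from the right. The rank one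
  -- identities are `x (q p) = (x q) p` and `x τ'(q ⊗ p) = τ(x ⊗ q) p`.
  exact e.exists_ringEquiv (FMat.rowAct (LinearMap.mul k R).flip) (FMat.rowAct C.bimod.right)
    (FMat.rowAct_injective fun b hb => hE.eq_zero_of_forall_mul hb)
    (FMat.rowAct_injective fun b hb => C.eq_zero_of_forall_right hF hτ' hb)
    (FMat.rowAct_mul fun a b x => (mul_assoc x a b).symm)
    (FMat.rowAct_mul C.bimod.right_mul)
    (FMat.range_rowAct (fun a b => a * b) (fun q p x => (mul_assoc x q p).symm) hE.span_mul)
    (FMat.range_rowAct (fun m' m => C.swap.pair m' m) (fun q p x => (C.left_pair x q p).symm)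
      (C.swap.span_pair hτ'))
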